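/- Let $G$ be an undirected graph with node set $[n]=\{1,\dots,n\}$, and let $K_1,\dots,K_m\subseteq[n]$ be a clique cover of $G$: every $K_j$ is a clique of $G$, every node of $G$ lies in some $K_j$, and both ends of every edge of $G$ lie in a common $K_j$. For each $j\in[m]$ introduce a slack index $n+j$ and put $\bar K_j=K_j\cup\{n+j\}$. Let $c\in\mathbb R^{n+m}$ be a cost vector (in particular one with $c_{n+j}=0$ for all $j\in[m]$) and let $T>0$. The smoothed clique cover relaxation is the problem $$\max_{x\in[0,1]^{n+m}}\ \langle c,x\rangle - T\sum_{i=1}^{n+m}\bigl(x_i\log x_i-x_i\bigr)\quad\text{s.t.}\quad \sum_{i\in\bar K_j}x_i=1,\ \ j\in[m],$$ where $0\log 0=0$. The naive Bregman (Sinkhorn) method starts from $x_i=\exp(c_i/T)$, $i\in[n+m]$, and repeats outer iterations indefinitely; one outer iteration processes the cliques $j=1,2,\dots,m$ in this order, and processing $j$ means computing $s=\sum_{i\in\bar K_j}x_i$ and replacing $x_i$ by $x_i/s$ for all $i\in\bar K_j$, while all other coordinates are kept. Then the smoothed clique cover relaxation has exactly one solution $x^*$, and the iterates of the method converge to $x^*$: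 the vectors obtained after $k$ outer iterations converge to $x^*$ as $k\to\infty$, and so do, for every $r\in\{0,\dots,m\}$, the vectors obtained after $k$ outer iterations followed by the processing of the first $r$ cliques. -/

import Mathlib

open Filter Topology

namespace CliqueCover

/-- The sets `K j`, `j ∈ [m]`, form a clique cover of the graph `G` on the node set `[n]`:
each of them is a clique, and together they cover all nodes and all edges. -/
structure IsCliqueCover {n m : ℕ} (G : SimpleGraph (Fin n)) (K : Fin m → Finset (Fin n)) :
    Prop where
  isClique : ∀ j, G.IsClique (K j : Set (Fin n))
  covers_nodes : ∀ i, ∃ j, i ∈ K j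
  covers_edges : ∀ i i', G.Adj i i' → ∃ j, i ∈ K j ∧ i' ∈ K j

/-- The index set `[n + m]`: `Sum.inl i` is the node `i ∈ [n]`, and `Sum.inr j` is the slack
index `n + j` of the clique `j ∈ [m]`. -/
abbrev Idx (n m : ℕ) : Type := Fin n ⊕ Fin m

/-- The clique with its slack index, `K̄ j = K j ∪ {n + j}`. -/
def extClique {n m : ℕ} (K : Fin m → Finset (Fin n)) (j : Fin m) : Finset (Idx n m) :=
  (K j).disjSum {j}

/-- The feasible set of the relaxation: `x ∈ [0,1]^(n+m)` with `∑_{i ∈ K̄ j} x i = 1` for all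
`j ∈ [m]`. -/
def feasibleSet {n m : ℕ} (K : Fin m → Finset (Fin n)) : Set (Idx n m → ℝ) :=
  {x | (∀ i, x i ∈ Set.Icc (0 : ℝ) 1) ∧ ∀ j, ∑ i ∈ extClique K j, x i = 1}

/-- The shifted entropy `H(x) = -∑ i, (x i * log (x i) - x i)`, with `0 * log 0 = 0`. -/
noncomputable def entropy {n m : ℕ} (x : Idx n m → ℝ) : ℝ :=
  -∑ i, (x i * Real.log (x i) - x i)

/-- The smoothed objective `⟨c, x⟩ + T * H(x)`. -/
noncomputable def smoothedObjective {n m : ℕ} (c : Idx n m → ℝ) (T : ℝ) (x : Idx n m → ℝ) : ℝ :=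
  ∑ i, c i * x i + T * entropy x

/-- `x` is a solution of the smoothed clique cover relaxation: it is feasible and maximizes the
smoothed objective over the feasible set. -/
def IsSolution {n m : ℕ} (K : Fin m → Finset (Fin n)) (c : Idx n m → ℝ) (T : ℝ)
    (x : Idx n m → ℝ) : Prop :=
  x ∈ feasibleSet K ∧ IsMaxOn (smoothedObjective c T) (feasibleSet K) x

/-- One inner step: divide the coordinates in `K̄ j` by their sum, keep all the others. -/
noncomputable def normalizeClique {n m : ℕ} (K : Fin m → Finset (Fin n)) (x : Idx n m → ℝ)
    (j : Fin m) : Idx n m → ℝ :=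
  fun i => if i ∈ extClique K j then x i / ∑ l ∈ extClique K j, x l else x i

/-- The first `r` inner steps of one pass of the loop over the cliques `1, …, m`, in this order. -/
noncomputable def partialSweep {n m : ℕ} (K : Fin m → Finset (Fin n)) (r : ℕ)
    (x : Idx n m → ℝ) : Idx n m → ℝ :=
  ((List.finRange m).take r).foldl (normalizeClique K) x

/-- One outer iteration: a full pass over the cliques `1, …, m`. -/
noncomputable def sweep {n m : ℕ} (K : Fin m → Finset (Fin n)) (x : Idx n m → ℝ) :
    Idx n m → ℝ :=
  (List.finRange m).foldl (normalizeClique K) x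

/-- The state of the algorithm after `k` outer iterations, started at `x = exp (c / T)`. -/
noncomputable def outerIterate {n m : ℕ} (K : Fin m → Finset (Fin n)) (c : Idx n m → ℝ) (T : ℝ)
    (k : ℕ) : Idx n m → ℝ :=
  (sweep K)^[k] (fun i => Real.exp (c i / T))

/-- The state of the algorithm after `k` outer iterations and `r` further inner steps. -/
noncomputable def innerIterate {n m : ℕ} (K : Fin m → Finset (Fin n)) (c : Idx n m → ℝ) (T : ℝ)
    (k r : ℕ) : Idx n m → ℝ :=
  partialSweep K r (outerIterate K c T k)

end CliqueCover

namespace CliqueCover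

/-- The unnormalized Kullback-Leibler divergence. -/
noncomputable def divergence {ι : Type*} [Fintype ι] (z x : ι → ℝ) : ℝ :=
  ∑ i, (z i * Real.log (z i) - z i * Real.log (x i) - z i + x i)

theorem divergence_term_eq {z x : ℝ} (hx : 0 < x) :
    z * Real.log z - z * Real.log x - z + x = x * InformationTheory.klFun (z / x) := by
  rw [InformationTheory.klFun_apply]
  rcases eq_or_ne z 0 with rfl | hz
  · simp
  · rw [Real.log_div hz hx.ne']
    field_simp
    ring

theorem divergence_term_nonneg {z x : ℝ} (hz : 0 ≤ z) (hx : 0 < x) :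
    0 ≤ z * Real.log z - z * Real.log x - z + x := by
  rw [divergence_term_eq hx]
  exact mul_nonneg hx.le (InformationTheory.klFun_nonneg (div_nonneg hz hx.le))

section Divergence

variable {ι : Type*} [Fintype ι] {z x : ι → ℝ}

theorem divergence_nonneg (hz : ∀ i, 0 ≤ z i) (hx : ∀ i, 0 < x i) : 0 ≤ divergence z x :=
  Finset.sum_nonneg fun i _ => divergence_term_nonneg (hz i) (hx i)

theorem divergence_self (x : ι → ℝ) : divergence x x = 0 := by
  simp [divergence]

theorem eq_of_divergence_nonpos (hz : ∀ i, 0 ≤ z i) (hx : ∀ i, 0 < x i)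
    (h : divergence z x ≤ 0) : z = x := by
  have h0 := le_antisymm h (divergence_nonneg hz hx)
  rw [divergence, Finset.sum_eq_zero_iff_of_nonneg
    fun i _ => divergence_term_nonneg (hz i) (hx i)] at h0
  funext i
  have hi := h0 i (Finset.mem_univ i)
  rw [divergence_term_eq (hx i), mul_eq_zero, or_iff_right (hx i).ne',
    InformationTheory.klFun_eq_zero_iff (div_nonneg (hz i) (hx i).le)] at hi
  exact (div_eq_one_iff_eq (hx i).ne').1 hi

theorem tendsto_divergence {α : Type*} {l : Filter α} {u : α → ι → ℝ} (z : ι → ℝ)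
    (hx : ∀ i, 0 < x i) (hu : Tendsto u l (𝓝 x)) :
    Tendsto (fun a => divergence z (u a)) l (𝓝 (divergence z x)) := by
  refine tendsto_finsetSum _ fun i _ => ?_
  have hi := tendsto_pi_nhds.1 hu i
  exact ((tendsto_const_nhds.sub (tendsto_const_nhds.mul (hi.log (hx i).ne'))).sub
    tendsto_const_nhds).add hi

theorem exists_bounds_of_divergence_term_le {z : ℝ} (hz : 0 < z) (C : ℝ) :
    ∃ a b : ℝ, 0 < a ∧
      ∀ x, 0 < x → z * Real.log z - z * Real.log x - z + x ≤ C → x ∈ Set.Icc a b := by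
  refine ⟨Real.exp ((z * Real.log z - z - C) / z),
    2 * (C - z * Real.log z + z * Real.log (2 * z)), Real.exp_pos _, fun x hx h => ⟨?_, ?_⟩⟩
  · rw [← Real.le_log_iff_exp_le hx, div_le_iff₀ hz]
    linarith
  · have h1 := Real.log_le_sub_one_of_pos (div_pos hx (mul_pos two_pos hz))
    rw [Real.log_div hx.ne' (mul_pos two_pos hz).ne'] at h1
    have h2 := mul_le_mul_of_nonneg_left h1 hz.le
    have h3 : z * (x / (2 * z) - 1) = x / 2 - z := by field_simp
    rw [h3] at h2
    linarith

theorem exists_box_of_divergence_le (hz : ∀ i, 0 < z i) (C : ℝ) :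
    ∃ a b : ι → ℝ, (∀ i, 0 < a i) ∧
      ∀ x : ι → ℝ, (∀ i, 0 < x i) → divergence z x ≤ C → x ∈ Set.Icc a b := by
  choose a b ha hab using fun i => exists_bounds_of_divergence_term_le (hz i) C
  refine ⟨a, b, ha, fun x hx h => ?_⟩
  have key : ∀ i, x i ∈ Set.Icc (a i) (b i) := fun i => hab i (x i) (hx i) <|
    (Finset.single_le_sum (fun j _ => divergence_term_nonneg (hz j).le (hx j))
      (Finset.mem_univ i)).trans h
  exact ⟨fun i => (key i).1, fun i => (key i).2⟩

end Divergence

theorem sq_sqrt_sub_one_le {s : ℝ} (hs : 0 < s) : (√s - 1) ^ 2 ≤ s - 1 - Real.log s := by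
  have h1 := Real.log_le_sub_one_of_pos (Real.sqrt_pos.2 hs)
  rw [Real.log_sqrt hs.le] at h1
  nlinarith [Real.sq_sqrt hs.le]

theorem tendsto_one_of_sub_one_sub_log {α : Type*} {l : Filter α} {s : α → ℝ}
    (hs : ∀ a, 0 < s a) (h : Tendsto (fun a => s a - 1 - Real.log (s a)) l (𝓝 0)) :
    Tendsto s l (𝓝 1) := by
  have h1 : Tendsto (fun a => (√(s a) - 1) ^ 2) l (𝓝 0) :=
    squeeze_zero (fun _ => sq_nonneg _) (fun a => sq_sqrt_sub_one_le (hs a)) h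
  have h2 : Tendsto (fun a => √(s a) - 1) l (𝓝 0) := by
    rw [tendsto_zero_iff_abs_tendsto_zero]
    simpa [Real.sqrt_sq_eq_abs, Function.comp_def] using h1.sqrt
  have h3 : Tendsto (fun a => (√(s a) - 1 + 1) ^ 2) l (𝓝 ((0 + 1) ^ 2)) :=
    (h2.add_const 1).pow 2
  simpa [Real.sq_sqrt (hs _).le] using h3

variable {n m : ℕ} {K : Fin m → Finset (Fin n)}

theorem inr_mem_extClique (K : Fin m → Finset (Fin n)) (j : Fin m) :
    Sum.inr j ∈ extClique K j := by
  simp [extClique]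

theorem sum_extClique (K : Fin m → Finset (Fin n)) (j : Fin m) (x : Idx n m → ℝ) :
    ∑ i ∈ extClique K j, x i = ∑ i ∈ K j, x (Sum.inl i) + x (Sum.inr j) := by
  simp [extClique, Finset.sum_disjSum]

theorem exists_pos_mem_feasibleSet (K : Fin m → Finset (Fin n)) :
    ∃ p ∈ feasibleSet K, ∀ i, 0 < p i := by
  have hn : (0 : ℝ) < n + 1 := by positivity
  have hcard : ∀ j, ((K j).card : ℝ) ≤ n := fun j => by
    exact_mod_cast (Finset.card_le_univ (K j)).trans_eq (Fintype.card_fin n)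
  have hpos : ∀ i, 0 < (Sum.elim (fun _ => 1 / ((n : ℝ) + 1))
      (fun j => 1 - (K j).card * (1 / ((n : ℝ) + 1))) : Idx n m → ℝ) i := by
    rintro (i | j)
    · simp only [Sum.elim_inl]; positivity
    · simp only [Sum.elim_inr]
      rw [mul_one_div, sub_pos, div_lt_one hn]
      linarith [hcard j]
  refine ⟨_, ⟨fun i => ⟨(hpos i).le, ?_⟩, fun j => ?_⟩, hpos⟩
  · rcases i with i | j
    · simp only [Sum.elim_inl]
      rw [div_le_one hn]
      linarith [n.cast_nonneg (α := ℝ)]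
    · simp only [Sum.elim_inr]
      linarith [mul_nonneg ((K j).card.cast_nonneg (α := ℝ)) (one_div_nonneg.2 hn.le)]
  · rw [sum_extClique]
    simp

theorem sum_extClique_pos {x : Idx n m → ℝ} (hx : ∀ i, 0 < x i) (j : Fin m) :
    0 < ∑ i ∈ extClique K j, x i :=
  Finset.sum_pos (fun i _ => hx i) ⟨_, inr_mem_extClique K j⟩

theorem normalizeClique_pos {x : Idx n m → ℝ} (hx : ∀ i, 0 < x i) (j : Fin m) (i : Idx n m) :
    0 < normalizeClique K x j i := by
  unfold normalizeClique
  split_ifs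
  · exact div_pos (hx i) (sum_extClique_pos hx j)
  · exact hx i

/-- Normalizing a clique lowers the divergence by the same amount for all feasible points. -/
theorem divergence_normalizeClique {z x : Idx n m → ℝ} (hz : z ∈ feasibleSet K)
    (hx : ∀ i, 0 < x i) (j : Fin m) :
    divergence z x = divergence z (normalizeClique K x j) +
      (∑ i ∈ extClique K j, x i - 1 - Real.log (∑ i ∈ extClique K j, x i)) := by
  have hs := sum_extClique_pos (K := K) hx j
  set s := ∑ i ∈ extClique K j, x i with hsdef
  have key : divergence z x - divergence z (normalizeClique K x j) =
      ∑ i ∈ extClique K j, (x i - x i / s - z i * Real.log s) := by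
    rw [divergence, divergence, ← Finset.sum_sub_distrib, ← Finset.sum_filter_add_sum_filter_not
      Finset.univ (· ∈ extClique K j), Finset.filter_univ_mem]
    rw [Finset.sum_eq_zero (s := Finset.univ.filter (· ∉ extClique K j)), add_zero]
    · refine Finset.sum_congr rfl fun i hi => ?_
      simp only [normalizeClique, if_pos hi, ← hsdef]
      rw [Real.log_div (hx i).ne' hs.ne']
      ring
    · intro i hi
      simp [normalizeClique, (Finset.mem_filter.1 hi).2]
  rw [Finset.sum_sub_distrib, Finset.sum_sub_distrib, ← Finset.sum_div, ← Finset.sum_mul,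
    hz.2 j, ← hsdef, div_self hs.ne'] at key
  linarith

/-- `x'` is positive, and replacing `x` by `x'` lowers the divergence from all feasible points by
the same nonnegative amount. -/
def Descends (K : Fin m → Finset (Fin n)) (x x' : Idx n m → ℝ) : Prop :=
  (∀ i, 0 < x' i) ∧ ∃ g : ℝ, 0 ≤ g ∧ ∀ z ∈ feasibleSet K, divergence z x = divergence z x' + g

theorem Descends.refl {x : Idx n m → ℝ} (hx : ∀ i, 0 < x i) : Descends K x x :=
  ⟨hx, 0, le_rfl, fun _ _ => (add_zero _).symm⟩

theorem Descends.trans {x y z : Idx n m → ℝ} (h : Descends K x y) (h' : Descends K y z) :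
    Descends K x z := by
  obtain ⟨-, g, hg, h⟩ := h
  obtain ⟨hz, g', hg', h'⟩ := h'
  exact ⟨hz, g' + g, add_nonneg hg' hg, fun w hw => by rw [h w hw, h' w hw, add_assoc]⟩

theorem Descends.divergence_le {x x' z : Idx n m → ℝ} (h : Descends K x x')
    (hz : z ∈ feasibleSet K) : divergence z x' ≤ divergence z x := by
  obtain ⟨-, g, hg, h⟩ := h
  linarith [h z hz]

theorem descends_normalizeClique {x : Idx n m → ℝ} (hx : ∀ i, 0 < x i) (j : Fin m) :
    Descends K x (normalizeClique K x j) :=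
  ⟨normalizeClique_pos hx j, _,
    (sq_nonneg _).trans (sq_sqrt_sub_one_le (sum_extClique_pos hx j)),
    fun _ hz => divergence_normalizeClique hz hx j⟩

theorem descends_foldl (L : List (Fin m)) {x : Idx n m → ℝ} (hx : ∀ i, 0 < x i) :
    Descends K x (L.foldl (normalizeClique K) x) := by
  induction L generalizing x with
  | nil => exact .refl hx
  | cons j L ih => exact (descends_normalizeClique hx j).trans (ih (normalizeClique_pos hx j))

variable {c : Idx n m → ℝ} {T : ℝ}

theorem outerIterate_succ (K : Fin m → Finset (Fin n)) (c : Idx n m → ℝ) (T : ℝ) (k : ℕ) :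
    outerIterate K c T (k + 1) = sweep K (outerIterate K c T k) :=
  Function.iterate_succ_apply' _ _ _

theorem descends_outerIterate (K : Fin m → Finset (Fin n)) (c : Idx n m → ℝ) (T : ℝ) (k : ℕ) :
    Descends K (fun i => Real.exp (c i / T)) (outerIterate K c T k) := by
  induction k with
  | zero => exact .refl fun i => Real.exp_pos _
  | succ k ih =>
    rw [outerIterate_succ]
    exact ih.trans (descends_foldl _ ih.1)

theorem descends_innerIterate (K : Fin m → Finset (Fin n)) (c : Idx n m → ℝ) (T : ℝ) (k r : ℕ) :
    Descends K (outerIterate K c T k) (innerIterate K c T k r) :=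
  descends_foldl _ (descends_outerIterate K c T k).1

theorem descends_innerIterate_outerIterate_succ (K : Fin m → Finset (Fin n)) (c : Idx n m → ℝ)
    (T : ℝ) (k r : ℕ) :
    Descends K (innerIterate K c T k r) (outerIterate K c T (k + 1)) := by
  have h : outerIterate K c T (k + 1) =
      ((List.finRange m).drop r).foldl (normalizeClique K) (innerIterate K c T k r) := by
    rw [outerIterate_succ, innerIterate, partialSweep, ← List.foldl_append, List.take_append_drop,
      sweep]
  rw [h]
  exact descends_foldl _ (descends_innerIterate K c T k r).1

theorem innerIterate_zero (K : Fin m → Finset (Fin n)) (c : Idx n m → ℝ) (T : ℝ) (k : ℕ) :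
    innerIterate K c T k 0 = outerIterate K c T k := rfl

theorem innerIterate_succ (K : Fin m → Finset (Fin n)) (c : Idx n m → ℝ) (T : ℝ) (k : ℕ)
    {r : ℕ} (hr : r < m) :
    innerIterate K c T k (r + 1) = normalizeClique K (innerIterate K c T k r) ⟨r, hr⟩ := by
  have h : (List.finRange m).take (r + 1) = (List.finRange m).take r ++ [⟨r, hr⟩] := by
    rw [List.take_succ_eq_append_getElem (by simpa using hr)]
    simp
  rw [innerIterate, partialSweep, h, List.foldl_append]
  rfl

theorem tendsto_sum_innerIterate (K : Fin m → Finset (Fin n)) (c : Idx n m → ℝ) (T : ℝ)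
    (j : Fin m) :
    Tendsto (fun k => ∑ i ∈ extClique K j, innerIterate K c T k j i) atTop (𝓝 1) := by
  obtain ⟨p, hp, hpos⟩ := exists_pos_mem_feasibleSet K
  have hin := fun k r => (descends_innerIterate K c T k r).1
  refine tendsto_one_of_sub_one_sub_log (fun k => sum_extClique_pos (hin k j) j) ?_
  have hanti : Antitone fun k => divergence p (outerIterate K c T k) :=
    antitone_nat_of_succ_le fun k =>
      ((descends_innerIterate K c T k 0).trans
        (descends_innerIterate_outerIterate_succ K c T k 0)).divergence_le hp
  have hbdd : BddBelow (Set.range fun k => divergence p (outerIterate K c T k)) := by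
    refine ⟨0, ?_⟩
    rintro _ ⟨k, rfl⟩
    exact divergence_nonneg (fun i => (hpos i).le) (descends_outerIterate K c T k).1
  have hlim := tendsto_atTop_ciInf hanti hbdd
  have hdiff := hlim.sub (hlim.comp (tendsto_add_atTop_nat 1))
  rw [sub_self] at hdiff
  refine squeeze_zero (fun k => (sq_nonneg _).trans
    (sq_sqrt_sub_one_le (sum_extClique_pos (hin k j) j))) (fun k => ?_) hdiff
  have h1 := (descends_innerIterate K c T k j).divergence_le hp
  have h2 := divergence_normalizeClique hp (hin k j) j
  have h3 := (descends_innerIterate_outerIterate_succ K c T k (j + 1)).divergence_le hp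
  rw [innerIterate_succ K c T k j.2] at h3
  simp only [Function.comp_apply]
  linarith

theorem tendsto_innerIterate_of_outerIterate {α : Type*} {l : Filter α} {u : α → ℕ}
    (hu : Tendsto u l atTop) {y : Idx n m → ℝ}
    (hy : Tendsto (fun a => outerIterate K c T (u a)) l (𝓝 y)) {r : ℕ} (hr : r ≤ m) :
    Tendsto (fun a => innerIterate K c T (u a) r) l (𝓝 y) := by
  induction r with
  | zero => simpa only [innerIterate_zero] using hy
  | succ r ih =>
    have ih := tendsto_pi_nhds.1 (ih (by omega))
    have hs := (tendsto_sum_innerIterate K c T ⟨r, hr⟩).comp hu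
    refine tendsto_pi_nhds.2 fun i => ?_
    simp only [innerIterate_succ K c T _ hr, normalizeClique]
    split_ifs
    · have h := (ih i).div hs one_ne_zero
      rw [div_one] at h
      exact h
    · exact ih i

theorem mem_feasibleSet_of_tendsto {α : Type*} {l : Filter α} [l.NeBot] {u : α → ℕ}
    (hcover : ∀ i, ∃ j, i ∈ K j) (hu : Tendsto u l atTop) {y : Idx n m → ℝ}
    (hpos : ∀ i, 0 < y i) (hy : Tendsto (fun a => outerIterate K c T (u a)) l (𝓝 y)) :
    y ∈ feasibleSet K := by
  have hsum : ∀ j, ∑ i ∈ extClique K j, y i = 1 := fun j =>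
    tendsto_nhds_unique
      (tendsto_finsetSum _ fun i _ =>
        tendsto_pi_nhds.1 (tendsto_innerIterate_of_outerIterate hu hy j.2.le) i)
      ((tendsto_sum_innerIterate K c T j).comp hu)
  refine ⟨fun i => ⟨(hpos i).le, ?_⟩, hsum⟩
  obtain ⟨j, hj⟩ : ∃ j, i ∈ extClique K j := by
    rcases i with i | j
    · obtain ⟨j, hj⟩ := hcover i
      exact ⟨j, by simpa [extClique] using hj⟩
    · exact ⟨j, inr_mem_extClique K j⟩
  exact (Finset.single_le_sum (fun l _ => (hpos l).le) hj).trans_eq (hsum j)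

theorem smoothedObjective_eq (hT : 0 < T) (z : Idx n m → ℝ) :
    smoothedObjective c T z =
      T * ∑ i, Real.exp (c i / T) - T * divergence z (fun i => Real.exp (c i / T)) := by
  rw [smoothedObjective, entropy, divergence, ← mul_sub, ← Finset.sum_sub_distrib,
    ← Finset.sum_neg_distrib, Finset.mul_sum, Finset.mul_sum, ← Finset.sum_add_distrib]
  refine Finset.sum_congr rfl fun i _ => ?_
  rw [Real.log_exp]
  field_simp
  ring

theorem smoothedObjective_of_tendsto {α : Type*} {l : Filter α} [l.NeBot] {u : α → ℕ}
    (hT : 0 < T) {y z : Idx n m → ℝ} (hy : y ∈ feasibleSet K) (hpos : ∀ i, 0 < y i)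
    (hlim : Tendsto (fun a => outerIterate K c T (u a)) l (𝓝 y)) (hz : z ∈ feasibleSet K) :
    smoothedObjective c T y = smoothedObjective c T z + T * divergence z y := by
  have h1 := (tendsto_divergence z hpos hlim).sub (tendsto_divergence y hpos hlim)
  have h2 : ∀ a, divergence z (outerIterate K c T (u a)) - divergence y (outerIterate K c T (u a))
      = divergence z (fun i => Real.exp (c i / T)) -
        divergence y (fun i => Real.exp (c i / T)) := fun a => by
    obtain ⟨-, g, -, h⟩ := descends_outerIterate K c T (u a)
    rw [h z hz, h y hy]
    ring
  simp only [h2, divergence_self, sub_zero] at h1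
  rw [← tendsto_nhds_unique tendsto_const_nhds h1, smoothedObjective_eq hT,
    smoothedObjective_eq hT]
  ring

theorem exists_subseq_tendsto_solution (hcover : ∀ i, ∃ j, i ∈ K j) (hT : 0 < T) {u : ℕ → ℕ}
    (hu : Tendsto u atTop atTop) :
    ∃ y, IsSolution K c T y ∧ (∀ z, IsSolution K c T z → z = y) ∧
      ∃ φ : ℕ → ℕ, Tendsto (fun k => outerIterate K c T (u (φ k))) atTop (𝓝 y) := by
  obtain ⟨p, hp, hppos⟩ := exists_pos_mem_feasibleSet K
  obtain ⟨a, b, ha, hab⟩ :=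
    exists_box_of_divergence_le hppos (divergence p (fun i => Real.exp (c i / T)))
  have hmem : ∀ k, outerIterate K c T (u k) ∈ Set.Icc a b := fun k =>
    hab _ (descends_outerIterate K c T (u k)).1 ((descends_outerIterate K c T (u k)).divergence_le hp)
  obtain ⟨y, hyab, φ, hφ, hlim⟩ := isCompact_Icc.tendsto_subseq hmem
  have hpos : ∀ i, 0 < y i := fun i => (ha i).trans_le (hyab.1 i)
  have hy : y ∈ feasibleSet K :=
    mem_feasibleSet_of_tendsto hcover (hu.comp hφ.tendsto_atTop) hpos hlim
  have hobj := fun z (hz : z ∈ feasibleSet K) =>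
    smoothedObjective_of_tendsto (u := u ∘ φ) hT hy hpos hlim hz
  refine ⟨y, ⟨hy, fun z hz => ?_⟩, fun z hz => ?_, φ, hlim⟩
  · have := mul_nonneg hT.le (divergence_nonneg (fun i => (hz.1 i).1) hpos)
    change smoothedObjective c T z ≤ smoothedObjective c T y
    linarith [hobj z hz]
  · refine eq_of_divergence_nonpos (fun i => (hz.1.1 i).1) hpos ?_
    have h : smoothedObjective c T y ≤ smoothedObjective c T z := hz.2 hy
    refine nonpos_of_mul_nonpos_right ?_ hT
    linarith [hobj z hz.1]

end CliqueCover

theorem mainTheorem3 {n m : ℕ} (G : SimpleGraph (Fin n)) (K : Fin m → Finset (Fin n))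
    (hK : CliqueCover.IsCliqueCover G K) (c : CliqueCover.Idx n m → ℝ) (T : ℝ) (hT : 0 < T) :
    ∃ x : CliqueCover.Idx n m → ℝ,
      CliqueCover.IsSolution K c T x ∧
      (∀ y, CliqueCover.IsSolution K c T y → y = x) ∧
      Tendsto (fun k => CliqueCover.outerIterate K c T k) atTop (𝓝 x) ∧
      ∀ r ≤ m, Tendsto (fun k => CliqueCover.innerIterate K c T k r) atTop (𝓝 x) := by
  obtain ⟨x, hx, hunique, -⟩ :=
    CliqueCover.exists_subseq_tendsto_solution (c := c) hK.covers_nodes hT tendsto_id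
  have hlim : Tendsto (fun k => CliqueCover.outerIterate K c T k) atTop (𝓝 x) := by
    refine tendsto_of_subseq_tendsto fun u hu => ?_
    obtain ⟨y, hy, -, φ, hφ⟩ :=
      CliqueCover.exists_subseq_tendsto_solution (c := c) hK.covers_nodes hT hu
    exact ⟨φ, hunique y hy ▸ hφ⟩
  exact ⟨x, hx, hunique, hlim, fun r hr =>
    CliqueCover.tendsto_innerIterate_of_outerIterate tendsto_id hlim hr⟩
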